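/- Let $f_1,\dots,f_N:\mathbb R^n\to\mathbb R^n$ be similarities with ratios $0<\rho_i<1$, i.e. $|f_i(x)-f_i(y)|=\rho_i|x-y|$, which satisfy the open set condition: there is a non-empty open set $U$ with $f_i(U)\subseteq U$ for all $i$ and $f_i(U)\cap f_j(U)=\emptyset$ for $i\ne j$. (The inhomogeneous open set condition for $f_1,\dots,f_N$ and a compact set $C$ is this condition with an additional requirement relating $U$ and $C$; that requirement is not needed.) For a word $\omega=\omega_1\cdots\omega_k$ write $f_\omega=f_{\omega_1}\circ\cdots\circ f_{\omega_k}$ and $\rho_\omega=\rho_{\omega_1}\cdots\rho_{\omega_k}$ (the empty word gives the identity and $1$). Let $S\subseteq\{1,\dots,N\}^{\mathbb N}$ be compact and closed under the left shift, let $S^k$ be the set of the initial words of length $k$ of elements of $S$, and $S^*=\bigcup_{k\ge 0}S^k$. Let $E\subseteq\mathbb R^n$ be a sub-self-similar set, i.e. non-empty and compact with $E\subseteq\bigcup_i f_i(E)$, that is coded by $S$: $E=\{\lim_{k}f_{\omega_1\cdots\omega_k}(z):\omega\in S\}$, where the limits do not depend on $z\in\mathbb R^n$. Let $C\subseteq\mathbb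 R^n$ be compact, and put $$O_S=\bigcup_{\omega\in S^*}f_\omega(C),\qquad F=E\cup O_S .$$ A non-empty compact set $A$ is called an inhomogeneous sub-self-similar (ISSS) set of a finite family $(g_j)$ of contracting similarities with condensation set $D$ if $A\subseteq\bigcup_j g_j(A)\cup D$. Then $F$ is an ISSS set of $f_1,\dots,f_N$ with condensation set $C$. For every $k\ge1$ let $I_k=\{f_\omega:\omega\in S^k\}$. There are a unique non-empty compact set $E_k$ with $E_k=\bigcup_{\omega\in S^k}f_\omega(E_k)$ and a unique real number $s_k$ with $\sum_{\omega\in S^k}\rho_\omega^{s_k}=1$. Put $F_k=E_k\cup O_S$. Then $F_k$ is an ISSS set of $I_k$ with condensation set $\bigcup_{\omega\in S^*,\,|\omega|<k}f_\omega(C)$, and $$s_k\ge0,\qquad \dim_H E_k=s_k,\qquad \dim_H F_k=\max\{s_k,\dim_H C\}\qquad(k\ge1),$$ $$\dim_H E=\lim_{k\to\infty}\dim_H E_k=\lim_{k\to\infty}s_k,\qquad \lim_{k\to\infty}\dim_H F_k=\dim_H F .$$ -/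

import Mathlib

open Filter Topology

namespace ISSS

/-- A point of the code space `I^∞` over the alphabet `{1, …, N}`; `ω 0` is the first letter.
The topology is the product topology, which the metrics `d_∞` induce. -/
abbrev Code (N : ℕ) : Type := ℕ → Fin N

/-- The left shift `ω₁ω₂ω₃… ↦ ω₂ω₃…`. -/
def shift {N : ℕ} (ω : Code N) : Code N := fun j => ω (j + 1)

/-- The word `ω₁ … ω_k`. -/
def pre {N : ℕ} (ω : Code N) (k : ℕ) : List (Fin N) := List.ofFn fun j : Fin k => ω j

/-- `S^k`, the set of the initial words of length `k` of the elements of `S`. -/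
def words {N : ℕ} (S : Set (Code N)) (k : ℕ) : Set (List (Fin N)) := (fun ω => pre ω k) '' S

theorem words_finite {N : ℕ} (S : Set (Code N)) (k : ℕ) : (words S k).Finite := by
  refine (List.finite_length_eq (Fin N) k).subset ?_
  rintro _ ⟨ω, _, rfl⟩
  simp [pre]

/-- `f_w = f_{w₁} ∘ ⋯ ∘ f_{w_k}`; the empty word gives the identity. -/
def wordMap {N : ℕ} {X : Type*} (f : Fin N → X → X) (w : List (Fin N)) (x : X) : X :=
  w.foldr (fun i y => f i y) x

/-- `ρ_w = ρ_{w₁} ⋯ ρ_{w_k}`. -/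
def wordRatio {N : ℕ} (ρ : Fin N → ℝ) (w : List (Fin N)) : ℝ := (w.map ρ).prod

/-- The sum `∑_{w ∈ S^k} ρ_w ^ t`. -/
noncomputable def levelSum {N : ℕ} (ρ : Fin N → ℝ) (S : Set (Code N)) (k : ℕ) (t : ℝ) : ℝ :=
  ∑ w ∈ (words_finite S k).toFinset, wordRatio ρ w ^ t

/-- `Θ(S)`: all limits `lim_k f_{ω₁} ∘ ⋯ ∘ f_{ω_k} (z)` with `ω ∈ S`, where the limit does not
depend on the base point `z`. -/
def codedSet {N : ℕ} {X : Type*} [TopologicalSpace X] (f : Fin N → X → X)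
    (S : Set (Code N)) : Set X :=
  {x | ∃ ω ∈ S, ∀ z : X, Tendsto (fun k => wordMap f (pre ω k) z) atTop (𝓝 x)}

/-- `A` is a self-similar set of the iterated function system `g`. -/
def IsSelfSimilar {ι X : Type*} [TopologicalSpace X] (g : ι → X → X) (A : Set X) : Prop :=
  A.Nonempty ∧ IsCompact A ∧ A = ⋃ i, g i '' A

/-- `F` is a sub-self-similar set of the iterated function system `g`. -/
def IsSubSelfSimilar {ι X : Type*} [TopologicalSpace X] (g : ι → X → X) (F : Set X) : Prop :=
  F.Nonempty ∧ IsCompact F ∧ F ⊆ ⋃ i, g i '' F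

/-- `F` is an inhomogeneous sub-self-similar set of the iterated function system `g` with
condensation set `C`. -/
def IsInhomSubSelfSimilar {ι X : Type*} [TopologicalSpace X] (g : ι → X → X) (C F : Set X) :
    Prop :=
  F.Nonempty ∧ IsCompact F ∧ F ⊆ (⋃ i, g i '' F) ∪ C

/-- The iterated function system `I_k = {f_w : w ∈ S^k}`. -/
def blockIFS {N : ℕ} {X : Type*} (f : Fin N → X → X) (S : Set (Code N)) (k : ℕ) :
    words S k → X → X :=
  fun w => wordMap f (w : List (Fin N))

/-- The union of the sets `f_w(C)` over the words `w` of `S` of length less than `k`, among them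
the empty word. -/
def orbitBelow {N : ℕ} {X : Type*} (f : Fin N → X → X) (S : Set (Code N)) (C : Set X) (k : ℕ) :
    Set X :=
  ⋃ j, ⋃ _ : j < k, ⋃ w ∈ words S j, wordMap f w '' C

/-- `O_S`, the union of the sets `f_w(C)` over all finite initial words `w` of elements of `S`,
among them the empty word. -/
def orbit {N : ℕ} {X : Type*} (f : Fin N → X → X) (S : Set (Code N)) (C : Set X) : Set X :=
  ⋃ j, ⋃ w ∈ words S j, wordMap f w '' C

/-- The open set condition. Every version of the inhomogeneous open set condition consists of this
and of a further requirement that relates `U` to the condensation set. -/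
def OpenSetCondition {ι X : Type*} [TopologicalSpace X] (g : ι → X → X) : Prop :=
  ∃ U : Set X, IsOpen U ∧ U.Nonempty ∧ (∀ i, g i '' U ⊆ U) ∧
    ∀ i j, i ≠ j → Disjoint (g i '' U) (g j '' U)

end ISSS

/-! Iterating the maps f_w, w ∈ S^k, on a point of E_k keeps it in E_k and leads to every coded
point in the limit, so E ⊆ E_k (`codedSet_subset`). Distinct words of S^k have equal length, hence
are incomparable; so I_k inherits the open set condition with the same open set, and dim E_k = s_k.
Thus dim E ≤ s_k.

The converse rests on `levelSum_bounded_of_dimH_lt`: for t > dim E the sums of ρ_w^t over S^k stay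
bounded. Cover E by balls with ∑ r_i^t small. For each ball take the words whose ratio first drops
to r_i or below and whose cylinder is near the ball. The open set condition leaves boundedly many of
them, so the total of ρ_w^t is at most 1. Every code of S begins with one of these words, and
cutting off such beginnings bounds all level sums. For t' > t the level sums then tend to 0, hence
s_k < t' eventually.

The same lemma for the full shift yields the lower bound in dim E_k = s_k: there the level sums are
powers of one number, which boundedness forces to be at most 1. Finally O_S is a countable union of
similar copies of C, among them C, so it contributes exactly dim C to F and F_k. -/

namespace ISSS

/-! ### Words, their maps and their ratios -/

section Words

variable {N : ℕ} {X : Type*}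

@[simp] theorem length_pre (ω : Code N) (k : ℕ) : (pre ω k).length = k := by simp [pre]

@[simp] theorem pre_zero (ω : Code N) : pre ω 0 = [] := by simp [pre]

theorem pre_succ (ω : Code N) (k : ℕ) : pre ω (k + 1) = ω 0 :: pre (shift ω) k := by
  simp [pre, List.ofFn_succ, shift]

theorem pre_add (ω : Code N) (m k : ℕ) :
    pre ω (m + k) = pre ω m ++ pre (shift^[m] ω) k := by
  induction m generalizing ω with
  | zero => simp
  | succ m ih =>
    rw [show m + 1 + k = (m + k) + 1 by ring, pre_succ, pre_succ, ih, Function.iterate_succ_apply]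
    simp

theorem iterate_shift_mem {S : Set (Code N)} (hS : ∀ ω ∈ S, shift ω ∈ S) {ω : Code N}
    (h : ω ∈ S) (m : ℕ) : shift^[m] ω ∈ S := by
  induction m generalizing ω with
  | zero => exact h
  | succ m ih => exact ih (hS ω h)

theorem pre_mem_words {S : Set (Code N)} {ω : Code N} (h : ω ∈ S) (k : ℕ) :
    pre ω k ∈ words S k := ⟨ω, h, rfl⟩

theorem length_of_mem_words {S : Set (Code N)} {k : ℕ} {w : List (Fin N)} (h : w ∈ words S k) :
    w.length = k := by
  obtain ⟨ω, _, rfl⟩ := h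
  simp

@[simp] theorem wordMap_nil (f : Fin N → X → X) (x : X) : wordMap f [] x = x := rfl

@[simp] theorem wordMap_cons (f : Fin N → X → X) (i : Fin N) (w : List (Fin N)) (x : X) :
    wordMap f (i :: w) x = f i (wordMap f w x) := rfl

theorem wordMap_append (f : Fin N → X → X) (u v : List (Fin N)) (x : X) :
    wordMap f (u ++ v) x = wordMap f u (wordMap f v x) := by
  simp [wordMap]

@[simp] theorem wordRatio_nil (ρ : Fin N → ℝ) : wordRatio ρ [] = 1 := rfl

@[simp] theorem wordRatio_cons (ρ : Fin N → ℝ) (i : Fin N) (w : List (Fin N)) :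
    wordRatio ρ (i :: w) = ρ i * wordRatio ρ w := by
  simp [wordRatio]

theorem wordRatio_append (ρ : Fin N → ℝ) (u v : List (Fin N)) :
    wordRatio ρ (u ++ v) = wordRatio ρ u * wordRatio ρ v := by
  simp [wordRatio]

theorem wordRatio_pos {ρ : Fin N → ℝ} (hρ : ∀ i, 0 < ρ i) (w : List (Fin N)) :
    0 < wordRatio ρ w := by
  induction w with
  | nil => simp
  | cons i w ih => simpa using mul_pos (hρ i) ih

theorem wordRatio_le_pow {ρ : Fin N → ℝ} (hρ : ∀ i, 0 < ρ i) {c : ℝ} (hc : ∀ i, ρ i ≤ c)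
    (w : List (Fin N)) : wordRatio ρ w ≤ c ^ w.length := by
  induction w with
  | nil => simp
  | cons i w ih =>
    rw [wordRatio_cons, List.length_cons, pow_succ']
    exact mul_le_mul (hc i) ih (wordRatio_pos hρ w).le ((hρ i).le.trans (hc i))

theorem wordRatio_le_one {ρ : Fin N → ℝ} (hρ : ∀ i, 0 < ρ i ∧ ρ i < 1) (w : List (Fin N)) :
    wordRatio ρ w ≤ 1 := by
  simpa using wordRatio_le_pow (fun i => (hρ i).1) (fun i => (hρ i).2.le) w

theorem wordRatio_lt_one {ρ : Fin N → ℝ} (hρ : ∀ i, 0 < ρ i ∧ ρ i < 1) {w : List (Fin N)}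
    (hw : w ≠ []) : wordRatio ρ w < 1 := by
  cases w with
  | nil => exact absurd rfl hw
  | cons i w =>
    rw [wordRatio_cons]
    exact mul_lt_one_of_nonneg_of_lt_one_left (hρ i).1.le (hρ i).2 (wordRatio_le_one hρ w)

theorem exists_ratio_bounds {ρ : Fin N → ℝ} (hρ : ∀ i, 0 < ρ i ∧ ρ i < 1) :
    ∃ b c : ℝ, 0 < b ∧ 0 < c ∧ c < 1 ∧ ∀ i, b ≤ ρ i ∧ ρ i ≤ c := by
  rcases isEmpty_or_nonempty (Fin N) with h | h
  · exact ⟨1 / 2, 1 / 2, by norm_num, by norm_num, by norm_num, fun i => isEmptyElim i⟩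
  · obtain ⟨i, hi⟩ := Finite.exists_min ρ
    obtain ⟨j, hj⟩ := Finite.exists_max ρ
    exact ⟨ρ i, ρ j, (hρ i).1, (hρ j).1, (hρ j).2, fun l => ⟨hi l, hj l⟩⟩

end Words

/-! ### Limit points of codes -/

section Limits

variable {N : ℕ} {X : Type*} [MetricSpace X] {f : Fin N → X → X} {ρ : Fin N → ℝ}

theorem dist_wordMap (hf : ∀ i x y, dist (f i x) (f i y) = ρ i * dist x y) (w : List (Fin N))
    (x y : X) : dist (wordMap f w x) (wordMap f w y) = wordRatio ρ w * dist x y := by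
  induction w with
  | nil => simp
  | cons i w ih => rw [wordMap_cons, wordMap_cons, hf, ih, wordRatio_cons, mul_assoc]

theorem lipschitzWith_wordMap (hρ : ∀ i, 0 < ρ i ∧ ρ i < 1)
    (hf : ∀ i x y, dist (f i x) (f i y) = ρ i * dist x y) (w : List (Fin N)) :
    LipschitzWith 1 (wordMap f w) :=
  LipschitzWith.of_dist_le_mul fun x y => by
    rw [dist_wordMap hf]
    exact mul_le_mul_of_nonneg_right (by simpa using wordRatio_le_one hρ w) dist_nonneg

theorem exists_code_limit [CompleteSpace X] [Nonempty X] (hρ : ∀ i, 0 < ρ i ∧ ρ i < 1)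
    (hf : ∀ i x y, dist (f i x) (f i y) = ρ i * dist x y) (ω : Code N) :
    ∃ x, ∀ z, Tendsto (fun k => wordMap f (pre ω k) z) atTop (𝓝 x) := by
  obtain ⟨b, c, hb, hc0, hc1, hbc⟩ := exists_ratio_bounds hρ
  obtain ⟨z₀⟩ := ‹Nonempty X›
  have hle : ∀ k, wordRatio ρ (pre ω k) ≤ c ^ k := fun k => by
    simpa using wordRatio_le_pow (fun i => (hρ i).1) (fun i => (hbc i).2) (pre ω k)
  obtain ⟨D, hD⟩ : ∃ D, ∀ i, dist z₀ (f i z₀) ≤ D := by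
    obtain ⟨D, hD⟩ := (Set.finite_range fun i => dist z₀ (f i z₀)).bddAbove
    exact ⟨D, fun i => hD ⟨i, rfl⟩⟩
  have hcau : CauchySeq fun k => wordMap f (pre ω k) z₀ := by
    refine cauchySeq_of_le_geometric c D hc1 fun k => ?_
    -- Consecutive terms are the images under one word map of `z₀` and of some `f i z₀`, whose
    -- distance is at most `D`.
    rw [pre_add ω k 1, wordMap_append, dist_wordMap hf, mul_comm D]
    refine mul_le_mul (hle k) ?_ dist_nonneg (pow_nonneg hc0.le k)
    simpa [pre_succ] using hD _
  obtain ⟨x, hx⟩ := cauchySeq_tendsto_of_complete hcau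
  refine ⟨x, fun z => hx.congr_dist ?_⟩
  refine squeeze_zero (fun _ => dist_nonneg) (fun k => ?_)
    (by simpa using (tendsto_pow_atTop_nhds_zero_of_lt_one hc0.le hc1).mul_const (dist z₀ z))
  rw [dist_wordMap hf]
  exact mul_le_mul_of_nonneg_right (hle k) dist_nonneg

/-- Every code in a shift-invariant `S` has a limit point `x ∈ Θ(S)`, and for each `m` the point
`x` is the image under `f_{ω|m}` of a point of `Θ(S)`. -/
theorem exists_mem_codedSet [CompleteSpace X] [Nonempty X] (hρ : ∀ i, 0 < ρ i ∧ ρ i < 1)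
    (hf : ∀ i x y, dist (f i x) (f i y) = ρ i * dist x y) {S : Set (Code N)}
    (hS : ∀ ω ∈ S, shift ω ∈ S) {ω : Code N} (hω : ω ∈ S) :
    ∃ x ∈ codedSet f S, ∀ m, ∃ y ∈ codedSet f S, wordMap f (pre ω m) y = x := by
  obtain ⟨x, hx⟩ := exists_code_limit hρ hf ω
  refine ⟨x, ⟨ω, hω, hx⟩, fun m => ?_⟩
  obtain ⟨y, hy⟩ := exists_code_limit hρ hf (shift^[m] ω)
  refine ⟨y, ⟨_, iterate_shift_mem hS hω m, hy⟩, ?_⟩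
  obtain ⟨z⟩ := ‹Nonempty X›
  have h1 := ((lipschitzWith_wordMap hρ hf (pre ω m)).continuous.tendsto y).comp (hy z)
  have h2 := (tendsto_add_atTop_iff_nat m).2 (hx z)
  refine tendsto_nhds_unique h1 (h2.congr fun k => ?_)
  rw [add_comm, pre_add, wordMap_append]
  rfl

theorem exists_wordMap_mem_codedSet [CompleteSpace X] [Nonempty X] (hρ : ∀ i, 0 < ρ i ∧ ρ i < 1)
    (hf : ∀ i x y, dist (f i x) (f i y) = ρ i * dist x y) {S : Set (Code N)}
    (hS : ∀ ω ∈ S, shift ω ∈ S) {k : ℕ} {w : List (Fin N)} (hw : w ∈ words S k) :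
    ∃ y ∈ codedSet f S, wordMap f w y ∈ codedSet f S := by
  obtain ⟨ω, hω, rfl⟩ := hw
  obtain ⟨x, hx, h⟩ := exists_mem_codedSet hρ hf hS hω
  obtain ⟨y, hy, rfl⟩ := h k
  exact ⟨y, hy, hx⟩

end Limits

end ISSS

namespace ISSS

/-! ### Disjoint cylinders and packing -/

section Packing

/-- A similarity of a Euclidean space is onto. -/
theorem similarity_surjective {n : ℕ} {g : EuclideanSpace ℝ (Fin n) → EuclideanSpace ℝ (Fin n)}
    {r : ℝ} (hr : 0 < r) (hg : ∀ x y, dist (g x) (g y) = r * dist x y) :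
    Function.Surjective g := by
  -- Rescaling gives an isometry, which strict convexity makes affine; an injective linear
  -- endomorphism in finite dimension is onto.
  have hi : Isometry fun x => r⁻¹ • g x := Isometry.of_dist_eq fun x y => by
    rw [dist_smul₀, hg, Real.norm_of_nonneg (inv_nonneg.2 hr.le), inv_mul_cancel_left₀ hr.ne']
  have hs : Function.Surjective hi.affineIsometryOfStrictConvexSpace := by
    rw [← AffineIsometry.coe_toAffineMap, ← AffineMap.linear_surjective_iff]
    exact LinearMap.surjective_of_injective
      hi.affineIsometryOfStrictConvexSpace.linearIsometry.injective
  intro y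
  obtain ⟨x, hx⟩ := hs (r⁻¹ • y)
  refine ⟨x, ?_⟩
  rw [Isometry.affineIsometryOfStrictConvexSpace_apply] at hx
  exact smul_right_injective _ (inv_ne_zero hr.ne') hx

variable {N : ℕ} {X : Type*}

theorem wordMap_surjective {f : Fin N → X → X} (hf : ∀ i, Function.Surjective (f i))
    (w : List (Fin N)) : Function.Surjective (wordMap f w) := by
  induction w with
  | nil => exact fun x => ⟨x, rfl⟩
  | cons i w ih => exact (hf i).comp ih

theorem wordMap_image_subset {f : Fin N → X → X} {U : Set X} (hU : ∀ i, f i '' U ⊆ U)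
    (w : List (Fin N)) : wordMap f w '' U ⊆ U := by
  induction w with
  | nil => rintro _ ⟨x, hx, rfl⟩; exact hx
  | cons i w ih =>
    rintro _ ⟨x, hx, rfl⟩
    exact hU i ⟨_, ih ⟨x, hx, rfl⟩, rfl⟩

/-- Incomparable words have disjoint cylinder images of an open set condition set. -/
theorem disjoint_wordMap_image {f : Fin N → X → X} (hf : ∀ i, Function.Injective (f i))
    {U : Set X} (hU : ∀ i, f i '' U ⊆ U)
    (hd : ∀ i j, i ≠ j → Disjoint (f i '' U) (f j '' U)) {u v : List (Fin N)}
    (huv : ¬ u <+: v) (hvu : ¬ v <+: u) :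
    Disjoint (wordMap f u '' U) (wordMap f v '' U) := by
  induction u generalizing v with
  | nil => exact absurd List.nil_prefix huv
  | cons i u ih =>
    cases v with
    | nil => exact absurd List.nil_prefix hvu
    | cons j v =>
      have himg : ∀ (a : Fin N) (w : List (Fin N)),
          wordMap f (a :: w) '' U = f a '' (wordMap f w '' U) := fun a w => by
        rw [Set.image_image]; rfl
      rw [himg, himg]
      by_cases hij : i = j
      · subst hij
        rw [Set.disjoint_image_iff (hf i)]
        exact ih (fun h => huv (List.prefix_cons_inj i |>.2 h))
          (fun h => hvu (List.prefix_cons_inj i |>.2 h))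
      · exact (hd i j hij).mono (Set.image_mono (wordMap_image_subset hU u))
          (Set.image_mono (wordMap_image_subset hU v))

/-- A family of points of a ball of radius `R r` with mutual distances at least `η r` has a
number of members that is bounded in terms of `R` and `η`. -/
theorem exists_packing_bound {X : Type*} [NormedAddCommGroup X] [NormedSpace ℝ X] [ProperSpace X]
    (R : ℝ) {η : ℝ} (hη : 0 < η) :
    ∃ q : ℕ, ∀ {ι : Type} (s : Set ι) (p : ι → X) (x : X) (r : ℝ), 0 < r →
      (∀ i ∈ s, dist (p i) x ≤ R * r) →
      (∀ i ∈ s, ∀ j ∈ s, i ≠ j → η * r ≤ dist (p i) (p j)) → s.Finite ∧ s.ncard ≤ q := by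
  -- After rescaling to unit size, two separated points cannot share a ball of radius `η / 2`, so
  -- the number of these balls is the bound.
  obtain ⟨T, -, hT, hcov⟩ := (isCompact_closedBall (0 : X) R).finite_cover_balls (half_pos hη)
  refine ⟨T.ncard, fun {ι} s p x r hr hsx hsep => ?_⟩
  have hnorm : ∀ i j, dist (r⁻¹ • (p i - x)) (r⁻¹ • (p j - x)) = r⁻¹ * dist (p i) (p j) := by
    intro i j
    rw [dist_smul₀, dist_sub_right, Real.norm_of_nonneg (inv_nonneg.2 hr.le)]
  have hex : ∀ i, ∃ y, i ∈ s → y ∈ T ∧ dist (r⁻¹ • (p i - x)) y < η / 2 := by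
    intro i
    by_cases hi : i ∈ s
    · have hmem : r⁻¹ • (p i - x) ∈ Metric.closedBall (0 : X) R := by
        rw [mem_closedBall_zero_iff, norm_smul, Real.norm_of_nonneg (inv_nonneg.2 hr.le),
          ← dist_eq_norm, inv_mul_le_iff₀ hr, mul_comm]
        exact hsx i hi
      obtain ⟨y, hy, hiy⟩ := Set.mem_iUnion₂.1 (hcov hmem)
      exact ⟨y, fun _ => ⟨hy, hiy⟩⟩
    · exact ⟨0, fun h => absurd h hi⟩
  choose F hF using hex
  have hinj : Set.InjOn F s := by
    intro i hi j hj hij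
    by_contra hne
    have h1 := (hF i hi).2
    have h2 := (hF j hj).2
    rw [← hij] at h2
    have h3 := dist_triangle_right (r⁻¹ • (p i - x)) (r⁻¹ • (p j - x)) (F i)
    rw [hnorm] at h3
    have h4 := hsep i hi j hj hne
    have h5 : η ≤ r⁻¹ * dist (p i) (p j) := by
      rw [le_inv_mul_iff₀ hr, mul_comm]; exact h4
    linarith
  have hmaps : Set.MapsTo F s T := fun i hi => (hF i hi).1
  exact ⟨Set.Finite.of_injOn hmaps hinj hT, Set.ncard_le_ncard_of_injOn F hmaps hinj hT⟩

end Packing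

/-! ### Ball covers from the Hausdorff dimension -/

section Covers

open MeasureTheory

/-- A compact set of Hausdorff dimension less than `t` has finite covers by balls with arbitrarily
small sum of the `t`-th powers of the radii. -/
theorem exists_ball_cover {X : Type*} [MetricSpace X] [Nonempty X] {E : Set X}
    (hE : IsCompact E) {t : ℝ}
    (ht : dimH E < ENNReal.ofReal t) {ε : ℝ} (hε : 0 < ε) :
    ∃ (I : Finset ℕ) (x : ℕ → X) (r : ℕ → ℝ), (∀ i ∈ I, 0 < r i) ∧
      (E ⊆ ⋃ i ∈ I, Metric.ball (x i) (r i)) ∧ ∑ i ∈ I, r i ^ t ≤ ε := by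
  have ht0 : 0 < t := ENNReal.ofReal_pos.1 (bot_le.trans_lt ht)
  borelize X
  have hzero : μH[t] E = 0 := by
    have := hausdorffMeasure_of_dimH_lt (d := t.toNNReal) ht
    rwa [Real.coe_toNNReal _ ht0.le] at this
  have hε2 : ENNReal.ofReal (ε / 2) ≠ 0 := by simpa using hε
  obtain ⟨A, hA, hA1, hAsum⟩ : ∃ A : ℕ → Set X, E ⊆ ⋃ n, A n ∧ (∀ n, Metric.ediam (A n) ≤ 1) ∧
      ∑' n, ⨆ _ : (A n).Nonempty, Metric.ediam (A n) ^ t < ENNReal.ofReal (ε / 2) := by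
    rw [Measure.hausdorffMeasure_apply] at hzero
    -- Scale 1 suffices: the cover only needs finite diameters.
    have h1 := (iSup_le_iff.1 hzero.le 1)
    have h2 := (iSup_le_iff.1 h1 one_pos).trans_lt (pos_iff_ne_zero.2 hε2)
    simpa only [iInf_lt_iff, exists_prop] using h2
  obtain ⟨δ, hδ, hδsum⟩ := ENNReal.exists_pos_sum_of_countable hε2 ℕ
  have hfin : ∀ n, Metric.ediam (A n) ≠ ⊤ := fun n => ((hA1 n).trans_lt ENNReal.one_lt_top).ne
  -- The summable `δ n` makes the radius positive and strictly larger than the diameter, even for a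
  -- one-point set, at total cost `ε / 2`.
  set r : ℕ → ℝ := fun n => (Metric.diam (A n) ^ t + δ n) ^ (1 / t) with hr
  have hbase : ∀ n, 0 < Metric.diam (A n) ^ t + δ n := fun n =>
    add_pos_of_nonneg_of_pos (Real.rpow_nonneg Metric.diam_nonneg t) (by exact_mod_cast hδ n)
  have hrpos : ∀ n, 0 < r n := fun n => Real.rpow_pos_of_pos (hbase n) _
  have hrt : ∀ n, r n ^ t = Metric.diam (A n) ^ t + δ n := fun n => by
    rw [hr]
    dsimp only
    rw [← Real.rpow_mul (hbase n).le, one_div_mul_cancel ht0.ne', Real.rpow_one]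
  have hlt : ∀ n, Metric.diam (A n) < r n := fun n => by
    rw [← Real.rpow_lt_rpow_iff Metric.diam_nonneg (hrpos n).le ht0, hrt]
    have : (0 : ℝ) < δ n := by exact_mod_cast hδ n
    linarith
  obtain ⟨e⟩ := ‹Nonempty X›
  have hcenter : ∀ n, ∃ x, (A n).Nonempty → x ∈ A n := fun n => by
    by_cases h : (A n).Nonempty
    · exact ⟨h.some, fun _ => h.some_mem⟩
    · exact ⟨e, fun h' => absurd h' h⟩
  choose x hx using hcenter
  obtain ⟨I, hI⟩ := hE.elim_finite_subcover (fun n : {n // (A n).Nonempty} =>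
    Metric.ball (x n) (r n)) (fun _ => Metric.isOpen_ball) (by
      intro y hy
      obtain ⟨n, hn⟩ := Set.mem_iUnion.1 (hA hy)
      refine Set.mem_iUnion.2 ⟨⟨n, y, hn⟩, ?_⟩
      exact (Metric.dist_le_diam_of_mem (Metric.isBounded_iff_ediam_ne_top.2 (hfin n)) hn
        (hx n ⟨y, hn⟩)).trans_lt (hlt n))
  refine ⟨I.map (Function.Embedding.subtype _), x, r, fun i _ => hrpos i, ?_, ?_⟩
  · simpa [Set.iUnion_subtype] using hI
  · rw [Finset.sum_map]
    have hle : ENNReal.ofReal (∑ i ∈ I, r i ^ t) ≤ ENNReal.ofReal ε := by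
      calc ENNReal.ofReal (∑ i ∈ I, r i ^ t)
          = ∑ i ∈ I, ((⨆ _ : (A i).Nonempty, Metric.ediam (A i) ^ t) + (δ i : ENNReal)) := by
            rw [ENNReal.ofReal_sum_of_nonneg fun i _ => Real.rpow_nonneg (hrpos _).le _]
            refine Finset.sum_congr rfl fun i _ => ?_
            rw [hrt, ENNReal.ofReal_add (Real.rpow_nonneg Metric.diam_nonneg t) (δ i).coe_nonneg,
              ENNReal.ofReal_coe_nnreal, iSup_pos i.2, Metric.diam,
              ENNReal.toReal_rpow, ENNReal.ofReal_toReal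
                (ENNReal.rpow_ne_top_of_nonneg ht0.le (hfin i))]
        _ = ∑ n ∈ I.map (Function.Embedding.subtype _),
              ((⨆ _ : (A n).Nonempty, Metric.ediam (A n) ^ t) + (δ n : ENNReal)) := by
            rw [Finset.sum_map]; rfl
        _ ≤ ∑' n, ((⨆ _ : (A n).Nonempty, Metric.ediam (A n) ^ t) + (δ n : ENNReal)) :=
            ENNReal.sum_le_tsum _
        _ ≤ ENNReal.ofReal (ε / 2) + ENNReal.ofReal (ε / 2) := by
            rw [ENNReal.tsum_add]
            exact add_le_add hAsum.le hδsum.le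
        _ = ENNReal.ofReal ε := by
            rw [← ENNReal.ofReal_add (half_pos hε).le (half_pos hε).le, add_halves]
    exact (ENNReal.ofReal_le_ofReal_iff hε.le).1 hle

end Covers

end ISSS

namespace ISSS

/-! ### Boundedness of the level sums above the dimension -/

section Core

variable {N : ℕ} {ρ : Fin N → ℝ}

theorem levelSum_nonneg (hρ : ∀ i, 0 < ρ i) (S : Set (Code N)) (k : ℕ) (t : ℝ) :
    0 ≤ levelSum ρ S k t :=
  Finset.sum_nonneg fun w _ => Real.rpow_nonneg (wordRatio_pos hρ w).le t

theorem sum_biUnion_le_sum {ι κ : Type*} [DecidableEq κ] (s : Finset ι) (T : ι → Finset κ)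
    {g : κ → ℝ} (hg : ∀ a, 0 ≤ g a) : ∑ a ∈ s.biUnion T, g a ≤ ∑ i ∈ s, ∑ a ∈ T i, g a := by
  classical
  induction s using Finset.induction_on with
  | empty => simp
  | insert i s hi ih =>
    rw [Finset.biUnion_insert, Finset.sum_insert hi]
    have := Finset.sum_union_inter (s₁ := T i) (s₂ := s.biUnion T) (f := g)
    have h0 : 0 ≤ ∑ a ∈ T i ∩ s.biUnion T, g a := Finset.sum_nonneg fun a _ => hg a
    linarith

/-- If every code of a shift-invariant `S` starts with a word of a finite set `W` of non-empty
words with `∑_{w ∈ W} ρ_w ^ t ≤ 1`, then the sums `∑_{w ∈ S^k} ρ_w ^ t` are bounded. -/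
theorem levelSum_bounded_of_stopping (hρ : ∀ i, 0 < ρ i) {S : Set (Code N)}
    (hS : ∀ ω ∈ S, shift ω ∈ S) {t : ℝ} (W : Finset (List (Fin N)))
    (hW : ∀ w ∈ W, w ≠ []) (hsum : ∑ w ∈ W, wordRatio ρ w ^ t ≤ 1)
    (hprefix : ∀ ω ∈ S, ∃ m, pre ω m ∈ W) : ∃ M, ∀ k, levelSum ρ S k t ≤ M := by
  classical
  obtain ⟨L, hL⟩ := (W.finite_toSet.image List.length).bddAbove
  obtain ⟨M, hM⟩ := ((Set.finite_le_nat L).image fun k => levelSum ρ S k t).bddAbove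
  have hM0 : 0 ≤ M := (levelSum_nonneg hρ S 0 t).trans (hM ⟨0, Nat.zero_le L, rfl⟩)
  refine ⟨M, fun k => ?_⟩
  induction k using Nat.strong_induction_on with
  | _ k ih =>
  rcases le_or_gt k L with hk | hk
  · exact hM ⟨k, hk, rfl⟩
  have hnn : ∀ w : List (Fin N), 0 ≤ wordRatio ρ w ^ t := fun w =>
    Real.rpow_nonneg (wordRatio_pos hρ w).le t
  -- As `k` exceeds every length in `W`, each word of S^k factors through a word of `W`; the rest is
  -- again a word of S, by shift invariance.
  have hsub : (words_finite S k).toFinset ⊆ W.biUnion fun u =>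
      (words_finite S (k - u.length)).toFinset.image fun v => u ++ v := by
    intro w hw
    obtain ⟨ω, hω, rfl⟩ := (Set.Finite.mem_toFinset _).1 hw
    obtain ⟨m, hm⟩ := hprefix ω hω
    have hmL : m ≤ L := hL ⟨_, hm, length_pre ω m⟩
    refine Finset.mem_biUnion.2 ⟨_, hm, Finset.mem_image.2
      ⟨pre (shift^[m] ω) (k - m), (Set.Finite.mem_toFinset _).2 ?_, ?_⟩⟩
    · rw [length_pre]
      exact pre_mem_words (iterate_shift_mem hS hω m) _
    · rw [← pre_add, Nat.add_sub_cancel' (hmL.trans hk.le)]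
  calc levelSum ρ S k t
      ≤ ∑ w ∈ W.biUnion fun u =>
          (words_finite S (k - u.length)).toFinset.image fun v => u ++ v, wordRatio ρ w ^ t :=
        Finset.sum_le_sum_of_subset_of_nonneg hsub fun w _ _ => hnn w
    _ ≤ ∑ u ∈ W, ∑ w ∈ (words_finite S (k - u.length)).toFinset.image fun v => u ++ v,
          wordRatio ρ w ^ t := sum_biUnion_le_sum _ _ hnn
    _ = ∑ u ∈ W, wordRatio ρ u ^ t * levelSum ρ S (k - u.length) t := by
        refine Finset.sum_congr rfl fun u _ => ?_
        rw [Finset.sum_image fun a _ b _ h => List.append_cancel_left h, levelSum, Finset.mul_sum]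
        refine Finset.sum_congr rfl fun v _ => ?_
        rw [wordRatio_append, Real.mul_rpow (wordRatio_pos hρ u).le (wordRatio_pos hρ v).le]
    _ ≤ ∑ u ∈ W, wordRatio ρ u ^ t * M := by
        refine Finset.sum_le_sum fun u hu => mul_le_mul_of_nonneg_left (ih _ ?_) (hnn u)
        have := List.length_pos_iff.2 (hW u hu)
        omega
    _ ≤ M := by
        rw [← Finset.sum_mul]
        exact mul_le_of_le_one_left hM0 hsum

/-- A word whose ratio is at most `r` and which is minimal with this property. -/
def IsStopping (ρ : Fin N → ℝ) (r : ℝ) (w : List (Fin N)) : Prop :=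
  w ≠ [] ∧ wordRatio ρ w ≤ r ∧ r < wordRatio ρ w.dropLast

/-- A proper extension of `u` has a parent that still extends `u`, so the parent's ratio is already
at most `r`. Stopping words at one scale thus form an antichain. -/
theorem IsStopping.eq_of_prefix (hρ : ∀ i, 0 < ρ i ∧ ρ i < 1) {r : ℝ} {u v : List (Fin N)}
    (hu : IsStopping ρ r u) (hv : IsStopping ρ r v) (h : u <+: v) : u = v := by
  obtain ⟨w, rfl⟩ := h
  by_cases hw : w = []
  · simp [hw]
  have h1 := hv.2.2
  rw [List.dropLast_append_of_ne_nil hw, wordRatio_append] at h1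
  have h2 := mul_le_of_le_one_right (wordRatio_pos (fun i => (hρ i).1) u).le
    (wordRatio_le_one hρ w.dropLast)
  linarith [hu.2.1]

theorem IsStopping.mul_le {b r : ℝ} (hρ : ∀ i, 0 < ρ i) (hb : 0 < b) (hbρ : ∀ i, b ≤ ρ i)
    {w : List (Fin N)} (hw : IsStopping ρ r w) : b * r ≤ wordRatio ρ w := by
  obtain ⟨hne, -, h⟩ := hw
  rw [← List.dropLast_append_getLast hne, wordRatio_append, mul_comm b]
  refine mul_le_mul h.le ?_ hb.le (wordRatio_pos hρ _).le
  simpa using hbρ _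

theorem exists_isStopping_pre (hρ : ∀ i, 0 < ρ i ∧ ρ i < 1) {r : ℝ} (hr0 : 0 < r) (hr1 : r < 1)
    (ω : Code N) : ∃ m, IsStopping ρ r (pre ω m) := by
  classical
  obtain ⟨b, c, hb, hc0, hc1, hbc⟩ := exists_ratio_bounds hρ
  have hex : ∃ m, wordRatio ρ (pre ω m) ≤ r := by
    obtain ⟨m, hm⟩ := exists_pow_lt_of_lt_one hr0 hc1
    refine ⟨m, le_trans ?_ hm.le⟩
    simpa using wordRatio_le_pow (fun i => (hρ i).1) (fun i => (hbc i).2) (pre ω m)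
  have h1 := Nat.find_spec hex
  obtain ⟨j, hj⟩ : ∃ j, Nat.find hex = j + 1 := by
    refine Nat.exists_eq_succ_of_ne_zero fun h0 => ?_
    rw [h0, pre_zero, wordRatio_nil] at h1
    linarith
  have h2 : ¬ wordRatio ρ (pre ω j) ≤ r := Nat.find_min hex (by omega)
  rw [hj] at h1
  refine ⟨j + 1, ?_, h1, ?_⟩
  · rw [pre_succ]; simp
  · rw [pre_add, List.dropLast_append_of_ne_nil (by simp [pre_succ])]
    simpa [pre_succ] using h2

/-- Under the open set condition, the sums `∑_{w ∈ S^k} ρ_w ^ t` are bounded for every `t` that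
exceeds the Hausdorff dimension of a compact set containing `Θ(S)`. -/
theorem levelSum_bounded_of_dimH_lt {n : ℕ}
    {f : Fin N → EuclideanSpace ℝ (Fin n) → EuclideanSpace ℝ (Fin n)}
    (hρ : ∀ i, 0 < ρ i ∧ ρ i < 1) (hf : ∀ i x y, dist (f i x) (f i y) = ρ i * dist x y)
    (hU : OpenSetCondition f) {S : Set (Code N)} (hS : ∀ ω ∈ S, shift ω ∈ S)
    {E : Set (EuclideanSpace ℝ (Fin n))} (hE : IsCompact E) (hSE : codedSet f S ⊆ E) {t : ℝ}
    (ht : dimH E < ENNReal.ofReal t) : ∃ M, ∀ k, levelSum ρ S k t ≤ M := by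
  classical
  have ht0 : 0 < t := ENNReal.ofReal_pos.1 (bot_le.trans_lt ht)
  have hρ0 : ∀ i, 0 < ρ i := fun i => (hρ i).1
  obtain ⟨U, hUo, ⟨u, hu⟩, hfU, hdisj⟩ := hU
  obtain ⟨δ, hδ, hball⟩ := Metric.isOpen_iff.1 hUo u hu
  obtain ⟨b, c, hb, -, -, hbc⟩ := exists_ratio_bounds hρ
  obtain ⟨D, hD⟩ := hE.isBounded.subset_closedBall u
  have hsurj : ∀ i, Function.Surjective (f i) := fun i => similarity_surjective (hρ0 i) (hf i)
  have hinj : ∀ i, Function.Injective (f i) := fun i x y h => by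
    have := hf i x y
    rw [h, dist_self] at this
    exact dist_eq_zero.1 ((mul_eq_zero.1 this.symm).resolve_left (hρ0 i).ne')
  obtain ⟨q, hq⟩ := exists_packing_bound (X := EuclideanSpace ℝ (Fin n)) (1 + |D|) (mul_pos hb hδ)
  let Z : EuclideanSpace ℝ (Fin n) → ℝ → Set (List (Fin N)) := fun x r =>
    {w | IsStopping ρ r w ∧ dist (wordMap f w u) x ≤ (1 + |D|) * r}
  have hZ : ∀ x r, 0 < r → (Z x r).Finite ∧ (Z x r).ncard ≤ q := by
    intro x r hr
    refine hq (Z x r) (fun w => wordMap f w u) x r hr (fun w hw => hw.2) ?_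
    intro w hw v hv hne
    have hdj := disjoint_wordMap_image hinj hfU hdisj
      (fun h => hne (hw.1.eq_of_prefix hρ hv.1 h))
      (fun h => hne (hv.1.eq_of_prefix hρ hw.1 h).symm)
    -- Surjectivity turns the disjointness of cylinders into separation: the preimage of the other
    -- centre lies outside `U`, hence at distance at least `δ` from `u`.
    obtain ⟨y, hy⟩ := wordMap_surjective hsurj w (wordMap f v u)
    have hyU : y ∉ U := fun hyU =>
      Set.disjoint_left.1 hdj ⟨y, hyU, hy⟩ ⟨u, hu, rfl⟩
    have hyd : δ ≤ dist u y := not_lt.1 fun h => hyU (hball (by rwa [Metric.mem_ball']))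
    rw [← hy, dist_wordMap hf]
    calc b * δ * r = (b * r) * δ := by ring
      _ ≤ wordRatio ρ w * dist u y :=
        mul_le_mul (hw.1.mul_le hρ0 hb fun i => (hbc i).1) hyd hδ.le (wordRatio_pos hρ0 w).le
  -- Chosen so that `q * ε ≤ 1` and, even for `q = 0`, `ε < 1`; the latter forces radii below 1, as
  -- the existence of stopping words requires.
  have hε : (0 : ℝ) < 1 / (q + 2) := by positivity
  obtain ⟨I, x, r, hr, hcov, hsum⟩ := exists_ball_cover hE ht hε
  have hr1 : ∀ i ∈ I, r i < 1 := by
    intro i hi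
    have h1 : r i ^ t ≤ 1 / (q + 2) :=
      (Finset.single_le_sum (f := fun i => r i ^ t)
        (fun j hj => Real.rpow_nonneg (hr j hj).le t) hi).trans hsum
    have h2 : (1 : ℝ) / (q + 2) < 1 := by
      rw [div_lt_one (by positivity)]
      linarith [Nat.cast_nonneg (α := ℝ) q]
    by_contra h
    have := Real.one_le_rpow (not_lt.1 h) ht0.le
    linarith
  -- The default `∅` is never used on `I`, where the radii are positive.
  let T : ℕ → Finset (List (Fin N)) := fun i =>
    if h : (Z (x i) (r i)).Finite then h.toFinset else ∅
  have hT : ∀ i ∈ I, ∀ w, w ∈ T i ↔ w ∈ Z (x i) (r i) := by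
    intro i hi w
    simp only [T, dif_pos (hZ (x i) (r i) (hr i hi)).1, Set.Finite.mem_toFinset]
  refine levelSum_bounded_of_stopping hρ0 hS (I.biUnion T) ?_ ?_ ?_
  · intro w hw
    obtain ⟨i, hi, hw⟩ := Finset.mem_biUnion.1 hw
    exact ((hT i hi w).1 hw).1.1
  · calc ∑ w ∈ I.biUnion T, wordRatio ρ w ^ t
        ≤ ∑ i ∈ I, ∑ w ∈ T i, wordRatio ρ w ^ t :=
          sum_biUnion_le_sum _ _ fun w => Real.rpow_nonneg (wordRatio_pos hρ0 w).le t
      _ ≤ ∑ i ∈ I, (q : ℝ) * r i ^ t := by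
          refine Finset.sum_le_sum fun i hi => ?_
          have hcard : (T i).card ≤ q := by
            have h := hZ (x i) (r i) (hr i hi)
            simp only [T, dif_pos h.1]
            rw [← Set.ncard_eq_toFinset_card _ h.1]
            exact h.2
          calc ∑ w ∈ T i, wordRatio ρ w ^ t ≤ ∑ w ∈ T i, r i ^ t :=
                Finset.sum_le_sum fun w hw => Real.rpow_le_rpow (wordRatio_pos hρ0 w).le
                  ((hT i hi w).1 hw).1.2.1 ht0.le
            _ = (T i).card * r i ^ t := by rw [Finset.sum_const, nsmul_eq_mul]
            _ ≤ q * r i ^ t := mul_le_mul_of_nonneg_right (by exact_mod_cast hcard)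
                  (Real.rpow_nonneg (hr i hi).le t)
      _ = q * ∑ i ∈ I, r i ^ t := by rw [Finset.mul_sum]
      _ ≤ q * (1 / (q + 2)) := mul_le_mul_of_nonneg_left hsum (Nat.cast_nonneg q)
      _ ≤ 1 := by
          rw [mul_one_div, div_le_one (by positivity)]
          linarith
  · intro ω hω
    obtain ⟨e, he, hpre⟩ := exists_mem_codedSet hρ hf hS hω
    obtain ⟨i, hi, hei⟩ := Set.mem_iUnion₂.1 (hcov (hSE he))
    obtain ⟨m, hm⟩ := exists_isStopping_pre hρ (hr i hi) (hr1 i hi) ω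
    refine ⟨m, Finset.mem_biUnion.2 ⟨i, hi, (hT i hi _).2 ⟨hm, ?_⟩⟩⟩
    -- The coded point is the image of some `y` in `E`, so `u` is mapped to within `r i * |D|` of
    -- it, and the point is within `r i` of the centre.
    obtain ⟨y, hy, rfl⟩ := hpre m
    have h1 : dist u y ≤ |D| := by
      rw [dist_comm]
      exact (Metric.mem_closedBall.1 (hD (hSE hy))).trans (le_abs_self D)
    have h2 := dist_triangle (wordMap f (pre ω m) u) (wordMap f (pre ω m) y) (x i)
    rw [dist_wordMap hf] at h2
    have h3 : wordRatio ρ (pre ω m) * dist u y ≤ r i * |D| :=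
      mul_le_mul hm.2.1 h1 dist_nonneg (hr i hi).le
    have h4 := Metric.mem_ball.1 hei
    linarith

end Core

end ISSS

namespace ISSS

/-! ### The root of a power sum -/

section PowerSums

variable {ι : Type*} {s : Finset ι} {r : ι → ℝ}

theorem strictAnti_sum_rpow (hs : s.Nonempty) (hr : ∀ i ∈ s, 0 < r i ∧ r i < 1) :
    StrictAnti fun t : ℝ => ∑ i ∈ s, r i ^ t := fun _ _ htt =>
  Finset.sum_lt_sum_of_nonempty hs fun i hi =>
    Real.rpow_lt_rpow_of_exponent_gt (hr i hi).1 (hr i hi).2 htt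

theorem one_le_sum_rpow_zero (hs : s.Nonempty) : 1 ≤ ∑ i ∈ s, r i ^ (0 : ℝ) := by
  simpa using hs.card_pos

theorem existsUnique_sum_rpow_eq_one (hs : s.Nonempty) (hr : ∀ i ∈ s, 0 < r i ∧ r i < 1) :
    ∃! t : ℝ, ∑ i ∈ s, r i ^ t = 1 := by
  have hanti := strictAnti_sum_rpow hs hr
  have hcont : Continuous fun t : ℝ => ∑ i ∈ s, r i ^ t :=
    continuous_finsetSum _ fun i hi => Real.continuous_const_rpow (hr i hi).1.ne'
  have hlim : Tendsto (fun t : ℝ => ∑ i ∈ s, r i ^ t) atTop (𝓝 0) := by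
    have := tendsto_finsetSum s fun i hi => tendsto_rpow_atTop_of_base_lt_one (r i)
      (by linarith [(hr i hi).1]) (hr i hi).2
    simpa using this
  obtain ⟨T, hT1, hT0⟩ := ((hlim.eventually (gt_mem_nhds one_pos)).and
    (eventually_ge_atTop (0 : ℝ))).exists
  obtain ⟨t, -, ht⟩ := intermediate_value_Icc' hT0 hcont.continuousOn
    ⟨hT1.le, one_le_sum_rpow_zero hs⟩
  exact ⟨t, ht, fun t' ht' => hanti.injective (ht'.trans ht.symm)⟩

theorem nonneg_of_sum_rpow_eq_one (hs : s.Nonempty) (hr : ∀ i ∈ s, 0 < r i ∧ r i < 1) {t : ℝ}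
    (ht : ∑ i ∈ s, r i ^ t = 1) : 0 ≤ t :=
  (strictAnti_sum_rpow hs hr).le_iff_ge.1 (ht.le.trans (one_le_sum_rpow_zero hs))

end PowerSums

/-! ### Level sums: decay, and the full shift -/

section LevelSums

variable {N : ℕ} {ρ : Fin N → ℝ} {S : Set (Code N)}

theorem toFinset_words_nonempty (hne : S.Nonempty) (k : ℕ) :
    (words_finite S k).toFinset.Nonempty :=
  (Set.Finite.toFinset_nonempty _).2 (hne.image _)

theorem wordRatio_mem_Ioo (hρ : ∀ i, 0 < ρ i ∧ ρ i < 1) {k : ℕ} (hk : 1 ≤ k)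
    {w : List (Fin N)} (hw : w ∈ words S k) : 0 < wordRatio ρ w ∧ wordRatio ρ w < 1 := by
  refine ⟨wordRatio_pos (fun i => (hρ i).1) w, wordRatio_lt_one hρ ?_⟩
  rw [← List.length_pos_iff, length_of_mem_words hw]
  exact hk

theorem wordRatio_mem_Ioo_of_mem_toFinset (hρ : ∀ i, 0 < ρ i ∧ ρ i < 1) {k : ℕ} (hk : 1 ≤ k) :
    ∀ w ∈ (words_finite S k).toFinset, 0 < wordRatio ρ w ∧ wordRatio ρ w < 1 :=
  fun _ hw => wordRatio_mem_Ioo hρ hk ((Set.Finite.mem_toFinset _).1 hw)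

/-- Raising the exponent multiplies each term by ρ_w^(t' - t), which is at most `(c ^ (t' - t)) ^ k`
on words of length `k`. -/
theorem tendsto_levelSum_of_bounded (hρ : ∀ i, 0 < ρ i ∧ ρ i < 1) {t t' M : ℝ} (htt : t < t')
    (hM : ∀ k, levelSum ρ S k t ≤ M) :
    Tendsto (fun k => levelSum ρ S k t') atTop (𝓝 0) := by
  obtain ⟨b, c, -, hc0, hc1, hbc⟩ := exists_ratio_bounds hρ
  have hρ0 : ∀ i, 0 < ρ i := fun i => (hρ i).1
  have hlim : Tendsto (fun k : ℕ => (c ^ (t' - t)) ^ k * M) atTop (𝓝 0) := by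
    simpa using (tendsto_pow_atTop_nhds_zero_of_lt_one (Real.rpow_nonneg hc0.le (t' - t))
      (Real.rpow_lt_one hc0.le hc1 (sub_pos.2 htt))).mul_const M
  refine squeeze_zero (fun k => levelSum_nonneg hρ0 S k t') (fun k => ?_) hlim
  calc levelSum ρ S k t'
      ≤ ∑ w ∈ (words_finite S k).toFinset, (c ^ (t' - t)) ^ k * wordRatio ρ w ^ t := by
        refine Finset.sum_le_sum fun w hw => ?_
        have hw0 := wordRatio_pos hρ0 w
        have hlen := length_of_mem_words ((Set.Finite.mem_toFinset _).1 hw)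
        have hwc := wordRatio_le_pow hρ0 (fun i => (hbc i).2) w
        rw [hlen] at hwc
        rw [show t' = (t' - t) + t by ring, Real.rpow_add hw0, add_sub_cancel_right]
        refine mul_le_mul_of_nonneg_right ?_ (Real.rpow_nonneg hw0.le t)
        rw [← Real.rpow_mul_natCast hc0.le, mul_comm, Real.rpow_natCast_mul hc0.le]
        exact Real.rpow_le_rpow hw0.le hwc (sub_pos.2 htt).le
    _ = (c ^ (t' - t)) ^ k * levelSum ρ S k t := by rw [levelSum, Finset.mul_sum]
    _ ≤ (c ^ (t' - t)) ^ k * M :=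
        mul_le_mul_of_nonneg_left (hM k) (pow_nonneg (Real.rpow_nonneg hc0.le _) k)

theorem cons_mem_words_univ {i : Fin N} {w : List (Fin N)} {k : ℕ} :
    i :: w ∈ words (Set.univ : Set (Code N)) (k + 1) ↔ w ∈ words (Set.univ : Set (Code N)) k := by
  constructor
  · rintro ⟨ω, -, h⟩
    simp only [pre_succ, List.cons.injEq] at h
    exact ⟨shift ω, trivial, h.2⟩
  · rintro ⟨ω, -, rfl⟩
    exact ⟨fun j => Nat.casesOn j i ω, trivial, pre_succ _ _⟩

theorem levelSum_univ [Nonempty (Fin N)] (hρ : ∀ i, 0 < ρ i) (k : ℕ) (t : ℝ) :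
    levelSum ρ Set.univ k t = (∑ i, ρ i ^ t) ^ k := by
  classical
  induction k with
  | zero =>
    have : (words_finite (Set.univ : Set (Code N)) 0).toFinset = {[]} := by
      ext w
      simp [words]
    simp [levelSum, this]
  | succ k ih =>
    have : (words_finite (Set.univ : Set (Code N)) (k + 1)).toFinset =
        (Finset.univ ×ˢ (words_finite (Set.univ : Set (Code N)) k).toFinset).image
          fun p => p.1 :: p.2 := by
      ext w
      simp only [Set.Finite.mem_toFinset, Finset.mem_image, Finset.mem_product, Finset.mem_univ,
        true_and, Prod.exists]
      constructor
      · intro hw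
        cases w with
        | nil => simpa using length_of_mem_words hw
        | cons i w => exact ⟨i, w, cons_mem_words_univ.1 hw, rfl⟩
      · rintro ⟨i, w, hw, rfl⟩
        exact cons_mem_words_univ.2 hw
    rw [levelSum, this, Finset.sum_image (by
      rintro ⟨a, b⟩ _ ⟨a', b'⟩ _ h
      simpa using h), Finset.sum_product, pow_succ', Finset.sum_mul]
    refine Finset.sum_congr rfl fun i _ => ?_
    rw [← ih, levelSum, Finset.mul_sum]
    refine Finset.sum_congr rfl fun w _ => ?_
    rw [wordRatio_cons, Real.mul_rpow (hρ i).le (wordRatio_pos hρ w).le]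

end LevelSums

/-! ### Dimension of self-similar sets -/

section SelfSimilar

/-- A non-empty closed set that is mapped into itself by the maps `f_w`, `w ∈ S^k`, contains
`Θ(S)`. -/
theorem codedSet_subset {N : ℕ} {X : Type*} [TopologicalSpace X] {f : Fin N → X → X}
    {S : Set (Code N)} (hS : ∀ ω ∈ S, shift ω ∈ S) {k : ℕ} (hk : 1 ≤ k) {A : Set X}
    (hne : A.Nonempty) (hA : IsClosed A) (hmap : ∀ w ∈ words S k, wordMap f w '' A ⊆ A) :
    codedSet f S ⊆ A := by
  rintro x ⟨ω, hω, hx⟩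
  obtain ⟨z, hz⟩ := hne
  have hmem : ∀ j : ℕ, ∀ ω ∈ S, wordMap f (pre ω (k * j)) z ∈ A := by
    intro j
    induction j with
    | zero => intro ω _; simpa using hz
    | succ j ih =>
      intro ω hω
      rw [show k * (j + 1) = k + k * j by ring, pre_add, wordMap_append]
      exact hmap _ (pre_mem_words hω k) ⟨_, ih _ (iterate_shift_mem hS hω k), rfl⟩
  have hlim : Tendsto (fun j : ℕ => wordMap f (pre ω (k * j)) z) atTop (𝓝 x) :=
    (hx z).comp (tendsto_id.const_mul_atTop' hk)
  exact hA.mem_of_tendsto hlim (Eventually.of_forall fun j => hmem j ω hω)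

theorem IsSelfSimilar.image_subset {ι X : Type*} [TopologicalSpace X] {g : ι → X → X} {A : Set X}
    (hA : IsSelfSimilar g A) (i : ι) : g i '' A ⊆ A := by
  conv_rhs => rw [hA.2.2]
  exact Set.subset_iUnion (fun i => g i '' A) i

theorem IsSelfSimilar.subset_iUnion_words {M : ℕ} {X : Type*} [TopologicalSpace X]
    {g : Fin M → X → X} {A : Set X} (hA : IsSelfSimilar g A) [Nonempty (Fin M)] (k : ℕ) :
    A ⊆ ⋃ w : words (Set.univ : Set (Code M)) k, wordMap g w '' A := by
  induction k with
  | zero =>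
    intro x hx
    obtain ⟨i⟩ := ‹Nonempty (Fin M)›
    exact Set.mem_iUnion.2 ⟨⟨pre (fun _ => i) 0, pre_mem_words (Set.mem_univ _) 0⟩, x, hx, by simp⟩
  | succ k ih =>
    intro x hx
    rw [hA.2.2] at hx
    obtain ⟨i, y, hy, rfl⟩ := Set.mem_iUnion.1 hx
    obtain ⟨⟨w, hw⟩, z, hz, rfl⟩ := Set.mem_iUnion.1 (ih hy)
    exact Set.mem_iUnion.2 ⟨⟨i :: w, cons_mem_words_univ.2 hw⟩, z, hz, rfl⟩

open MeasureTheory in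
/-- The dimension of a self-similar set is at most its similarity dimension. -/
theorem IsSelfSimilar.dimH_le {M : ℕ} {X : Type*} [MetricSpace X] {g : Fin M → X → X}
    {r : Fin M → ℝ} (hr : ∀ i, 0 < r i ∧ r i < 1)
    (hg : ∀ i x y, dist (g i x) (g i y) = r i * dist x y) [Nonempty (Fin M)]
    {A : Set X} (hA : IsSelfSimilar g A) {t : ℝ} (ht : ∑ i, r i ^ t = 1) :
    dimH A ≤ ENNReal.ofReal t := by
  have ht0 : 0 ≤ t := nonneg_of_sum_rpow_eq_one Finset.univ_nonempty (fun i _ => hr i) ht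
  have hr0 : ∀ i, 0 < r i := fun i => (hr i).1
  obtain ⟨b, c, -, hc0, hc1, hbc⟩ := exists_ratio_bounds hr
  have hfin : Metric.ediam A ≠ ⊤ := Metric.isBounded_iff_ediam_ne_top.1 hA.2.1.isBounded
  borelize X
  have hdiam : ∀ w : List (Fin M), Metric.ediam (wordMap g w '' A) ≤
      ENNReal.ofReal (wordRatio r w) * Metric.ediam A := fun w =>
    (LipschitzWith.of_dist_le_mul (K := (wordRatio r w).toNNReal) fun x y => by
      rw [dist_wordMap hg, Real.coe_toNNReal _ (wordRatio_pos hr0 w).le]).ediam_image_le A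
  have : ∀ k, Fintype (words (Set.univ : Set (Code M)) k) := fun k =>
    (words_finite _ k).fintype
  -- In the covers by cylinders of level `k`, the ratios contribute the factor `(∑ i, r i ^ t) ^ k =
  -- 1`, so the bound does not depend on `k`.
  have hle : μH[t] A ≤ Metric.ediam A ^ t := by
    refine (Measure.hausdorffMeasure_le_liminf_sum t A (l := atTop)
      (fun k : ℕ => ENNReal.ofReal (c ^ k) * Metric.ediam A) ?_
      (fun k (w : words (Set.univ : Set (Code M)) k) => wordMap g w '' A) ?_ ?_).trans ?_
    · have h1 : Tendsto (fun k : ℕ => ENNReal.ofReal (c ^ k)) atTop (𝓝 0) := by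
        simpa using ENNReal.tendsto_ofReal (tendsto_pow_atTop_nhds_zero_of_lt_one hc0.le hc1)
      simpa using ENNReal.Tendsto.mul_const h1 (Or.inr hfin)
    · refine Eventually.of_forall fun k w => (hdiam w).trans ?_
      gcongr
      have := wordRatio_le_pow hr0 (fun i => (hbc i).2) (w : List (Fin M))
      rwa [length_of_mem_words w.2] at this
    · exact Eventually.of_forall hA.subset_iUnion_words
    · refine liminf_le_of_frequently_le' (Frequently.of_forall fun k => ?_)
      calc ∑ w : words (Set.univ : Set (Code M)) k, Metric.ediam (wordMap g w '' A) ^ t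
          ≤ ∑ w : words (Set.univ : Set (Code M)) k,
              ENNReal.ofReal (wordRatio r w ^ t) * Metric.ediam A ^ t := by
            refine Finset.sum_le_sum fun w _ => ?_
            rw [← ENNReal.ofReal_rpow_of_pos (wordRatio_pos hr0 w),
              ← ENNReal.mul_rpow_of_nonneg _ _ ht0]
            exact ENNReal.rpow_le_rpow (hdiam w) ht0
        _ = ENNReal.ofReal (levelSum r Set.univ k t) * Metric.ediam A ^ t := by
            rw [← Finset.sum_mul, levelSum, ENNReal.ofReal_sum_of_nonneg fun w _ =>
              Real.rpow_nonneg (wordRatio_pos hr0 w).le t]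
            congr 1
            exact (Finset.sum_subtype _ (fun w => Set.Finite.mem_toFinset _)
              (fun w => ENNReal.ofReal (wordRatio r w ^ t))).symm
        _ = Metric.ediam A ^ t := by rw [levelSum_univ hr0, ht]; simp
  have hne : μH[(t.toNNReal : ℝ)] A ≠ ⊤ := by
    rw [Real.coe_toNNReal _ ht0]
    exact (hle.trans_lt (ENNReal.rpow_lt_top_of_nonneg ht0 hfin)).ne
  exact dimH_le_of_hausdorffMeasure_ne_top hne

/-- Under the open set condition, the dimension of a self-similar set is its similarity
dimension. -/
theorem IsSelfSimilar.dimH_eq {M n : ℕ}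
    {g : Fin M → EuclideanSpace ℝ (Fin n) → EuclideanSpace ℝ (Fin n)}
    {r : Fin M → ℝ} (hr : ∀ i, 0 < r i ∧ r i < 1)
    (hg : ∀ i x y, dist (g i x) (g i y) = r i * dist x y) (hU : OpenSetCondition g)
    {A : Set (EuclideanSpace ℝ (Fin n))} (hA : IsSelfSimilar g A) {t : ℝ}
    (ht : ∑ i, r i ^ t = 1) : dimH A = ENNReal.ofReal t := by
  have : Nonempty (Fin M) := by
    obtain ⟨x, hx⟩ := hA.1
    rw [hA.2.2] at hx
    exact ⟨(Set.mem_iUnion.1 hx).choose⟩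
  refine le_antisymm (hA.dimH_le hr hg ht) (not_lt.1 fun hlt => ?_)
  obtain ⟨d, hd1, hd2⟩ := ENNReal.lt_iff_exists_nnreal_btwn.1 hlt
  have hdt : (d : ℝ) < t := by
    rwa [← ENNReal.ofReal_coe_nnreal, ENNReal.ofReal_lt_ofReal_iff_of_nonneg d.coe_nonneg] at hd2
  rw [← ENNReal.ofReal_coe_nnreal] at hd1
  obtain ⟨B, hB⟩ := levelSum_bounded_of_dimH_lt hr hg hU (S := Set.univ) (fun _ _ => trivial)
    hA.2.1 (codedSet_subset (fun _ _ => Set.mem_univ _) le_rfl hA.1 hA.2.1.isClosed (by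
      rintro _ ⟨ω, -, rfl⟩ _ ⟨x, hx, rfl⟩
      simp only [pre_succ, pre_zero, wordMap_cons, wordMap_nil]
      exact hA.image_subset _ ⟨x, hx, rfl⟩)) hd1
  -- Below the root the power sum exceeds 1, so its powers, the level sums of the full shift, are
  -- unbounded.
  have h1 : 1 < ∑ i, r i ^ (d : ℝ) := by
    have := strictAnti_sum_rpow Finset.univ_nonempty (fun i _ => hr i) hdt
    simpa only [ht] using this
  obtain ⟨j, hj⟩ := pow_unbounded_of_one_lt B h1
  have := hB j
  rw [levelSum_univ fun i => (hr i).1] at this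
  linarith

end SelfSimilar

/-! ### Dimension of E_k -/

section Blocks

variable {n N : ℕ} {f : Fin N → EuclideanSpace ℝ (Fin n) → EuclideanSpace ℝ (Fin n)}
  {ρ : Fin N → ℝ} {S : Set (Code N)}

/-- The dimension of the self-similar set of `I_k` is the root of `∑_{w ∈ S^k} ρ_w ^ t = 1`. -/
theorem dimH_of_isSelfSimilar_blockIFS (hρ : ∀ i, 0 < ρ i ∧ ρ i < 1)
    (hf : ∀ i x y, dist (f i x) (f i y) = ρ i * dist x y) (hU : OpenSetCondition f)
    {k : ℕ} (hk : 1 ≤ k) {A : Set (EuclideanSpace ℝ (Fin n))}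
    (hA : IsSelfSimilar (blockIFS f S k) A) {t : ℝ} (ht : levelSum ρ S k t = 1) :
    dimH A = ENNReal.ofReal t := by
  have : Fintype (words S k) := (words_finite S k).fintype
  let e := (Fintype.equivFin (words S k)).symm
  have hinj : ∀ i, Function.Injective (f i) := fun i x y h => by
    have := hf i x y
    rw [h, dist_self] at this
    exact dist_eq_zero.1 ((mul_eq_zero.1 this.symm).resolve_left (hρ i).1.ne')
  refine IsSelfSimilar.dimH_eq (g := fun i => blockIFS f S k (e i))
    (r := fun i => wordRatio ρ (e i)) (fun i => wordRatio_mem_Ioo hρ hk (e i).2)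
    (fun i => dist_wordMap hf _) ?_ ⟨hA.1, hA.2.1, ?_⟩ ?_
  · obtain ⟨U, hUo, hUne, hfU, hd⟩ := hU
    refine ⟨U, hUo, hUne, fun i => wordMap_image_subset hfU _, fun i j hij => ?_⟩
    have hlen : ∀ i, (e i : List (Fin N)).length = k := fun i => length_of_mem_words (e i).2
    have hne : ∀ i j, i ≠ j → ¬ (e i : List (Fin N)) <+: (e j) := fun i j hij h =>
      hij (e.injective (Subtype.ext (h.eq_of_length ((hlen i).trans (hlen j).symm))))
    exact disjoint_wordMap_image hinj hfU hd (hne i j hij) (hne j i hij.symm)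
  · conv_lhs => rw [hA.2.2]
    exact (e.surjective.iUnion_comp fun w => blockIFS f S k w '' A).symm
  · rw [← ht, levelSum, e.sum_comp fun w : words S k => wordRatio ρ w ^ t]
    exact (Finset.sum_subtype _ (fun w => Set.Finite.mem_toFinset _)
      (fun w => wordRatio ρ w ^ t)).symm

end Blocks

end ISSS

namespace ISSS

/-! ### Existence and uniqueness of E_k -/

section Attractor

open TopologicalSpace in
/-- A finite non-empty family of contractions of a complete metric space has a unique self-similar
set. -/
theorem existsUnique_isSelfSimilar {ι X : Type*} [Finite ι] [Nonempty ι] [MetricSpace X]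
    [CompleteSpace X] [Nonempty X] {g : ι → X → X} {K : NNReal} (hK : K < 1)
    (hg : ∀ i, LipschitzWith K (g i)) : ∃! A, IsSelfSimilar g A := by
  let T : NonemptyCompacts X → NonemptyCompacts X := fun A =>
    ⟨⟨⋃ i, g i '' A, isCompact_iUnion fun i => A.isCompact.image (hg i).continuous⟩, by
      obtain ⟨i⟩ := ‹Nonempty ι›
      obtain ⟨x, hx⟩ := A.nonempty
      exact ⟨g i x, Set.mem_iUnion.2 ⟨i, x, hx, rfl⟩⟩⟩
  have himg : ∀ i (A B : NonemptyCompacts X), ∀ x ∈ g i '' (A : Set X),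
      Metric.infEDist x (g i '' (B : Set X)) ≤ K * Metric.hausdorffEDist (A : Set X) B := by
    rintro i A B _ ⟨a, ha, rfl⟩
    obtain ⟨y, hy, hay⟩ := B.isCompact.exists_infEDist_eq_edist B.nonempty a
    calc Metric.infEDist (g i a) (g i '' (B : Set X)) ≤ edist (g i a) (g i y) :=
          Metric.infEDist_le_edist_of_mem ⟨y, hy, rfl⟩
      _ ≤ K * edist a y := hg i a y
      _ ≤ K * Metric.hausdorffEDist (A : Set X) B := by
          rw [← hay]
          gcongr
          exact Metric.infEDist_le_hausdorffEDist_of_mem ha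
  have hT : ContractingWith K T := by
    refine ⟨hK, fun A B => ?_⟩
    change Metric.hausdorffEDist (⋃ i, g i '' (A : Set X)) (⋃ i, g i '' (B : Set X)) ≤
      K * Metric.hausdorffEDist (A : Set X) B
    refine Metric.hausdorffEDist_iUnion_le.trans (iSup_le fun i => ?_)
    refine Metric.hausdorffEDist_le_of_infEDist (himg i A B) fun x hx => ?_
    rw [Metric.hausdorffEDist_comm]
    exact himg i B A x hx
  have hfix : ∀ A : NonemptyCompacts X, T A = A ↔ (A : Set X) = ⋃ i, g i '' (A : Set X) :=
    fun A => by rw [← SetLike.coe_set_eq, eq_comm]; rfl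
  let P : NonemptyCompacts X := ContractingWith.fixedPoint T hT
  refine ⟨P, ⟨P.nonempty, P.isCompact, (hfix P).1 hT.fixedPoint_isFixedPt⟩, fun A hA => ?_⟩
  have := hT.fixedPoint_unique (x := ⟨⟨A, hA.2.1⟩, hA.1⟩) ((hfix _).2 hA.2.2)
  exact congrArg (fun B : NonemptyCompacts X => (B : Set X)) this

end Attractor

/-! ### Compactness of F and F_k -/

section Compactness

/-- A finite subcover of `K` already covers a thickening of `K`, hence all but finitely many `A j`.
-/
theorem isCompact_union_iUnion {X : Type*} [PseudoMetricSpace X] {K : Set X} (hK : IsCompact K)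
    {A : ℕ → Set X} (hA : ∀ j, IsCompact (A j))
    (h : ∀ ε > 0, ∃ J, ∀ j ≥ J, A j ⊆ Metric.thickening ε K) : IsCompact (K ∪ ⋃ j, A j) := by
  classical
  refine isCompact_of_finite_subcover fun {ι} U hU hcov => ?_
  obtain ⟨t₀, ht₀⟩ := hK.elim_finite_subcover U hU (Set.subset_union_left.trans hcov)
  obtain ⟨δ, hδ, hthick⟩ := hK.exists_thickening_subset_open
    (isOpen_biUnion fun i (_ : i ∈ t₀) => hU i) ht₀
  obtain ⟨J, hJ⟩ := h δ hδ
  obtain ⟨t₁, ht₁⟩ := ((Finset.range J).isCompact_biUnion fun j _ => hA j).elim_finite_subcover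
    U hU ((Set.iUnion₂_subset fun j _ => Set.subset_iUnion A j).trans
      (Set.subset_union_right.trans hcov))
  refine ⟨t₀ ∪ t₁, ?_⟩
  have h₀ : ⋃ i ∈ t₀, U i ⊆ ⋃ i ∈ t₀ ∪ t₁, U i :=
    Set.biUnion_subset_biUnion_left fun i hi => Finset.mem_union_left _ hi
  have h₁ : ⋃ i ∈ t₁, U i ⊆ ⋃ i ∈ t₀ ∪ t₁, U i :=
    Set.biUnion_subset_biUnion_left fun i hi => Finset.mem_union_right _ hi
  refine Set.union_subset (ht₀.trans h₀) (Set.iUnion_subset fun j => ?_)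
  rcases lt_or_ge j J with hj | hj
  · exact (Set.subset_biUnion_of_mem (u := A) (Finset.mem_coe.2 (Finset.mem_range.2 hj))).trans
      (ht₁.trans h₁)
  · exact (hJ j hj).trans (hthick.trans h₀)

variable {N : ℕ} {X : Type*} [MetricSpace X] {f : Fin N → X → X} {ρ : Fin N → ℝ}
  {S : Set (Code N)} {C : Set X}

theorem isCompact_union_orbit [CompleteSpace X] [Nonempty X] (hρ : ∀ i, 0 < ρ i ∧ ρ i < 1)
    (hf : ∀ i x y, dist (f i x) (f i y) = ρ i * dist x y) (hS : ∀ ω ∈ S, shift ω ∈ S)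
    (hC : IsCompact C) {K : Set X} (hK : IsCompact K) (hSK : codedSet f S ⊆ K) :
    IsCompact (K ∪ orbit f S C) := by
  refine isCompact_union_iUnion hK (fun j => (words_finite S j).isCompact_biUnion fun w _ =>
    hC.image (lipschitzWith_wordMap hρ hf w).continuous) fun ε hε => ?_
  obtain ⟨b, c, -, hc0, hc1, hbc⟩ := exists_ratio_bounds hρ
  have hlim : Tendsto (fun j : ℕ => c ^ j * Metric.diam (C ∪ K)) atTop (𝓝 0) := by
    simpa using (tendsto_pow_atTop_nhds_zero_of_lt_one hc0.le hc1).mul_const _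
  obtain ⟨J, hJ⟩ := eventually_atTop.1 (hlim.eventually (gt_mem_nhds hε))
  refine ⟨J, fun j hj => Set.iUnion₂_subset fun w hw => ?_⟩
  rintro _ ⟨x, hx, rfl⟩
  -- The cylinder of `w` contains a coded point, and a long word contracts `C ∪ K` onto a small
  -- neighbourhood of it.
  obtain ⟨y, hy, hwy⟩ := exists_wordMap_mem_codedSet hρ hf hS hw
  refine Metric.mem_thickening_iff.2 ⟨_, hSK hwy, lt_of_le_of_lt ?_ (hJ j hj)⟩
  rw [dist_wordMap hf]
  refine mul_le_mul ?_ (Metric.dist_le_diam_of_mem (hC.union hK).isBounded (Or.inl hx)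
    (Or.inr (hSK hy))) dist_nonneg (pow_nonneg hc0.le j)
  have := wordRatio_le_pow (fun i => (hρ i).1) (fun i => (hbc i).2) w
  rwa [length_of_mem_words hw] at this

end Compactness

/-! ### The orbit of the condensation set -/

section Orbit

variable {N : ℕ} {X : Type*} {f : Fin N → X → X} {S : Set (Code N)} {C : Set X}

theorem mem_orbit {x : X} :
    x ∈ orbit f S C ↔ ∃ j, ∃ w ∈ words S j, ∃ y ∈ C, wordMap f w y = x := by
  simp [orbit]

theorem orbit_subset (hS : ∀ ω ∈ S, shift ω ∈ S) (k : ℕ) :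
    orbit f S C ⊆ (⋃ w, blockIFS f S k w '' orbit f S C) ∪ orbitBelow f S C k := by
  intro x hx
  obtain ⟨j, w, hw, y, hy, rfl⟩ := mem_orbit.1 hx
  rcases lt_or_ge j k with hj | hj
  · exact Or.inr (Set.mem_iUnion₂.2 ⟨j, hj, Set.mem_iUnion₂.2 ⟨w, hw, y, hy, rfl⟩⟩)
  · obtain ⟨ω, hω, rfl⟩ := hw
    obtain ⟨m, rfl⟩ := Nat.exists_eq_add_of_le hj
    refine Or.inl (Set.mem_iUnion.2 ⟨⟨_, pre_mem_words hω k⟩, wordMap f (pre (shift^[k] ω) m) y,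
      mem_orbit.2 ⟨m, _, pre_mem_words (iterate_shift_mem hS hω k) m, y, hy, rfl⟩, ?_⟩)
    dsimp only
    rw [pre_add, wordMap_append]
    rfl

theorem subset_orbit (hne : S.Nonempty) : C ⊆ orbit f S C := by
  intro x hx
  obtain ⟨ω, hω⟩ := hne
  exact mem_orbit.2 ⟨0, _, pre_mem_words hω 0, x, hx, by simp⟩

theorem dimH_orbit {X : Type*} [MetricSpace X] {f : Fin N → X → X} {C : Set X} {ρ : Fin N → ℝ}
    (hρ : ∀ i, 0 < ρ i ∧ ρ i < 1)
    (hf : ∀ i x y, dist (f i x) (f i y) = ρ i * dist x y) (hne : S.Nonempty) :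
    dimH (orbit f S C) = dimH C := by
  refine le_antisymm ?_ (dimH_mono (subset_orbit hne))
  rw [orbit, dimH_iUnion]
  refine iSup_le fun j => ?_
  rw [dimH_bUnion (words_finite S j).countable]
  exact iSup₂_le fun w _ => (lipschitzWith_wordMap hρ hf w).dimH_image_le C

theorem isInhomSubSelfSimilar_blockIFS [TopologicalSpace X] (hS : ∀ ω ∈ S, shift ω ∈ S) {k : ℕ}
    {A : Set X} (hA : IsSelfSimilar (blockIFS f S k) A) (hc : IsCompact (A ∪ orbit f S C)) :
    IsInhomSubSelfSimilar (blockIFS f S k) (orbitBelow f S C k) (A ∪ orbit f S C) := by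
  refine ⟨hA.1.inl, hc, Set.union_subset ?_ ((orbit_subset hS k).trans ?_)⟩
  · refine hA.2.2.subset.trans (Set.subset_union_of_subset_left ?_ _)
    exact Set.iUnion_mono fun w => Set.image_mono Set.subset_union_left
  · exact Set.union_subset_union_left _
      (Set.iUnion_mono fun w => Set.image_mono Set.subset_union_right)

theorem isInhomSubSelfSimilar_union_orbit [TopologicalSpace X] (hS : ∀ ω ∈ S, shift ω ∈ S)
    {E : Set X} (hE : IsSubSelfSimilar f E) (hc : IsCompact (E ∪ orbit f S C)) :
    IsInhomSubSelfSimilar f C (E ∪ orbit f S C) := by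
  refine ⟨hE.1.inl, hc, Set.union_subset ?_ fun x hx => ?_⟩
  · refine hE.2.2.trans (Set.subset_union_of_subset_left ?_ _)
    exact Set.iUnion_mono fun w => Set.image_mono Set.subset_union_left
  · rcases orbit_subset hS 1 hx with h | h
    · obtain ⟨⟨_, ω, hω, rfl⟩, y, hy, rfl⟩ := Set.mem_iUnion.1 h
      exact Or.inl (Set.mem_iUnion.2 ⟨ω 0, y, Or.inr hy, by simp [blockIFS, pre_succ]⟩)
    · obtain ⟨j, hj, h⟩ := Set.mem_iUnion₂.1 h
      obtain ⟨_, ⟨ω, hω, rfl⟩, y, hy, rfl⟩ := Set.mem_iUnion₂.1 h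
      obtain rfl : j = 0 := by omega
      exact Or.inr (by simpa using hy)

end Orbit

/-! ### Convergence of the roots s_k -/

section Limit

variable {n N : ℕ} {f : Fin N → EuclideanSpace ℝ (Fin n) → EuclideanSpace ℝ (Fin n)}
  {ρ : Fin N → ℝ} {S : Set (Code N)}

theorem existsUnique_isSelfSimilar_blockIFS (hρ : ∀ i, 0 < ρ i ∧ ρ i < 1)
    (hf : ∀ i x y, dist (f i x) (f i y) = ρ i * dist x y) (hne : S.Nonempty) {k : ℕ}
    (hk : 1 ≤ k) : ∃! A, IsSelfSimilar (blockIFS f S k) A := by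
  have : Finite (words S k) := words_finite S k
  have : Nonempty (words S k) := (hne.image _).to_subtype
  obtain ⟨b, c, -, hc0, hc1, hbc⟩ := exists_ratio_bounds hρ
  refine existsUnique_isSelfSimilar (K := ⟨c, hc0.le⟩) hc1 fun w =>
    LipschitzWith.of_dist_le_mul fun x y => ?_
  rw [blockIFS, dist_wordMap hf]
  refine mul_le_mul_of_nonneg_right ?_ dist_nonneg
  refine (wordRatio_le_pow (fun i => (hρ i).1) (fun i => (hbc i).2) _).trans ?_
  rw [length_of_mem_words w.2]
  exact pow_le_of_le_one hc0.le hc1.le (by omega)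

/-- The roots `s_k` of `∑_{w ∈ S^k} ρ_w ^ t = 1` converge to the Hausdorff dimension of a compact
set containing `Θ(S)` if they are bounded below by it. -/
theorem tendsto_ofReal_root (hρ : ∀ i, 0 < ρ i ∧ ρ i < 1)
    (hf : ∀ i x y, dist (f i x) (f i y) = ρ i * dist x y) (hU : OpenSetCondition f)
    (hS : ∀ ω ∈ S, shift ω ∈ S) (hne : S.Nonempty)
    {E : Set (EuclideanSpace ℝ (Fin n))} (hE : IsCompact E) (hSE : codedSet f S ⊆ E) {s : ℕ → ℝ}
    (hs : ∀ k, 1 ≤ k → levelSum ρ S k (s k) = 1)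
    (hle : ∀ k, 1 ≤ k → dimH E ≤ ENNReal.ofReal (s k)) :
    Tendsto (fun k => ENNReal.ofReal (s k)) atTop (𝓝 (dimH E)) := by
  refine tendsto_order.2 ⟨fun a ha => ?_, fun a ha => ?_⟩
  · filter_upwards [eventually_ge_atTop 1] with k hk
    exact ha.trans_le (hle k hk)
  · obtain ⟨d, hd1, hd2⟩ := ENNReal.lt_iff_exists_nnreal_btwn.1 ha
    -- Two exponents are needed: boundedness at `d` gives decay at `d'`, and a level sum below 1
    -- there puts `s k` below `d'`.
    obtain ⟨d', hd3, hd4⟩ := ENNReal.lt_iff_exists_nnreal_btwn.1 hd2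
    rw [← ENNReal.ofReal_coe_nnreal] at hd1
    obtain ⟨M, hM⟩ := levelSum_bounded_of_dimH_lt hρ hf hU hS hE hSE hd1
    have hlim := tendsto_levelSum_of_bounded (t' := d') hρ (by exact_mod_cast hd3) hM
    filter_upwards [eventually_ge_atTop 1, hlim.eventually (gt_mem_nhds one_pos)] with k hk hlt
    have hanti := strictAnti_sum_rpow (toFinset_words_nonempty hne k)
      (wordRatio_mem_Ioo_of_mem_toFinset hρ hk)
    have hsd : s k < d' := hanti.lt_iff_gt.1 (hlt.trans_eq (hs k hk).symm)
    refine (ENNReal.ofReal_le_ofReal hsd.le).trans_lt ?_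
    rwa [ENNReal.ofReal_coe_nnreal]

end Limit

end ISSS

/-! ### The main theorem -/

theorem mainTheorem6 {n N : ℕ}
    (f : Fin N → EuclideanSpace ℝ (Fin n) → EuclideanSpace ℝ (Fin n)) (ρ : Fin N → ℝ)
    (hρ : ∀ i, 0 < ρ i ∧ ρ i < 1)
    (hf : ∀ i x y, dist (f i x) (f i y) = ρ i * dist x y)
    (hU : ISSS.OpenSetCondition f)
    (S : Set (ISSS.Code N)) (hS : IsCompact S) (hShift : ∀ ω ∈ S, ISSS.shift ω ∈ S)
    (E : Set (EuclideanSpace ℝ (Fin n))) (hE : ISSS.IsSubSelfSimilar f E)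
    (hES : ISSS.codedSet f S = E)
    (C : Set (EuclideanSpace ℝ (Fin n))) (hC : IsCompact C) :
    ISSS.IsInhomSubSelfSimilar f C (E ∪ ISSS.orbit f S C) ∧
    (∀ k, 1 ≤ k → ∃! A, ISSS.IsSelfSimilar (ISSS.blockIFS f S k) A) ∧
    (∀ k, 1 ≤ k → ∃! t : ℝ, ISSS.levelSum ρ S k t = 1) ∧
    ∀ (Ek : ℕ → Set (EuclideanSpace ℝ (Fin n))) (s : ℕ → ℝ),
      (∀ k, 1 ≤ k → ISSS.IsSelfSimilar (ISSS.blockIFS f S k) (Ek k)) →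
      (∀ k, 1 ≤ k → ISSS.levelSum ρ S k (s k) = 1) →
        (∀ k, 1 ≤ k → ISSS.IsInhomSubSelfSimilar (ISSS.blockIFS f S k)
          (ISSS.orbitBelow f S C k) (Ek k ∪ ISSS.orbit f S C)) ∧
        (∀ k, 1 ≤ k → 0 ≤ s k ∧ dimH (Ek k) = ENNReal.ofReal (s k) ∧
          dimH (Ek k ∪ ISSS.orbit f S C) = max (ENNReal.ofReal (s k)) (dimH C)) ∧
        Tendsto (fun k => dimH (Ek k)) atTop (𝓝 (dimH E)) ∧
        Tendsto (fun k => ENNReal.ofReal (s k)) atTop (𝓝 (dimH E)) ∧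
        Tendsto (fun k => dimH (Ek k ∪ ISSS.orbit f S C)) atTop
          (𝓝 (dimH (E ∪ ISSS.orbit f S C))) := by

  have hne : S.Nonempty := by
    obtain ⟨x, hx⟩ := hE.1
    rw [← hES] at hx
    obtain ⟨ω, hω, -⟩ := hx
    exact ⟨ω, hω⟩
  have hEc : ISSS.codedSet f S ⊆ E := hES.subset
  have hratio : ∀ k, 1 ≤ k → ∀ w ∈ (ISSS.words_finite S k).toFinset,
      0 < ISSS.wordRatio ρ w ∧ ISSS.wordRatio ρ w < 1 :=
    fun k hk => ISSS.wordRatio_mem_Ioo_of_mem_toFinset hρ hk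
  refine ⟨ISSS.isInhomSubSelfSimilar_union_orbit hShift hE
      (ISSS.isCompact_union_orbit hρ hf hShift hC hE.2.1 hEc),
    fun k hk => ISSS.existsUnique_isSelfSimilar_blockIFS hρ hf hne hk,
    fun k hk => ISSS.existsUnique_sum_rpow_eq_one (ISSS.toFinset_words_nonempty hne k)
      (hratio k hk), fun Ek s hEk hs => ?_⟩
  have hsub : ∀ k, 1 ≤ k → ISSS.codedSet f S ⊆ Ek k := fun k hk =>
    ISSS.codedSet_subset hShift hk (hEk k hk).1 (hEk k hk).2.1.isClosed
      fun w hw => (hEk k hk).image_subset ⟨w, hw⟩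
  have hdim : ∀ k, 1 ≤ k → dimH (Ek k) = ENNReal.ofReal (s k) := fun k hk =>
    ISSS.dimH_of_isSelfSimilar_blockIFS hρ hf hU hk (hEk k hk) (hs k hk)
  have hdimF : ∀ k, 1 ≤ k →
      dimH (Ek k ∪ ISSS.orbit f S C) = max (ENNReal.ofReal (s k)) (dimH C) := fun k hk => by
    rw [dimH_union, hdim k hk, ISSS.dimH_orbit hρ hf hne]
  have hlim : Tendsto (fun k => ENNReal.ofReal (s k)) atTop (𝓝 (dimH E)) :=
    ISSS.tendsto_ofReal_root hρ hf hU hShift hne hE.2.1 hEc hs fun k hk => by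
      rw [← hdim k hk, ← hES]
      exact dimH_mono (hsub k hk)
  refine ⟨fun k hk => ISSS.isInhomSubSelfSimilar_blockIFS hShift (hEk k hk)
      (ISSS.isCompact_union_orbit hρ hf hShift hC (hEk k hk).2.1 (hsub k hk)),
    fun k hk => ⟨ISSS.nonneg_of_sum_rpow_eq_one (ISSS.toFinset_words_nonempty hne k)
      (hratio k hk) (hs k hk), hdim k hk, hdimF k hk⟩, hlim.congr' ?_, hlim, ?_⟩
  · filter_upwards [eventually_ge_atTop 1] with k hk using (hdim k hk).symm
  · rw [dimH_union, ISSS.dimH_orbit hρ hf hne]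
    refine (hlim.max tendsto_const_nhds).congr' ?_
    filter_upwards [eventually_ge_atTop 1] with k hk using (hdimF k hk).symm
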